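/- A smooth global $1$-equivariant wave map is a map $U:[0,\infty)\times\mathbb R^2\to\mathbb S^2$, smooth on $[0,\infty)\times\mathbb R^2$, of the form $U(t,r,\omega)=(\sin\psi\cos\omega,\sin\psi\sin\omega,\cos\psi)$ in polar coordinates $(r,\omega)$ of $\mathbb R^2$, with $\psi=\psi(t,r)$ smooth on $[0,\infty)\times[0,\infty)$ and $$\psi_{tt}-\psi_{rr}-\frac1r\psi_r+\frac{\sin(2\psi)}{2r^2}=0 .$$ Write $\vec\psi(t)=(\psi(t),\psi_t(t))$. It belongs to the energy space $\mathcal H$ if $$\int_0^\infty\Big(\psi_t^2+\psi_r^2+\frac{\sin^2\psi}{r^2}\Big)\,r\,dr<\infty,\qquad \psi(t,0)=0,\qquad \psi(t,\infty):=\lim_{r\to\infty}\psi(t,r)\in\pi\mathbb Z .$$ Let $\psi$ be a smooth global $1$-equivariant wave map with $\vec\psi(t)\in\mathcal H$ for all $t\ge0$. Then there is $k\in\mathbb Z$ such that $\psi(t,\infty)=k\pi$ for all $t\ge 0$; for every $\lambda>0$, $$\sup_{r\ge\lambda t}|\psi(t,r)-\psi(t,\infty)|\to0\quad\text{as } t\to\infty;$$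 and for every $0<\lambda<1$, $$\limsup_{t\to\infty}\ \|\vec\psi(t)-(\psi(t,\infty),0)\|_{H\times L^2(\lambda t\le r\le t-A)}^2\to0\quad\text{as } A\to\infty,$$ where $\|(f,g)\|^2_{H\times L^2(a\le r\le b)}=\int_a^b\big(g^2+f_r^2+\frac{f^2}{r^2}\big)\,r\,dr$ (zero if $a>b$). -/

import Mathlib

open Filter Topology MeasureTheory Set
open scoped ContDiff ENNReal

noncomputable section

namespace EquivariantWaveMap

/-- The time derivative `∂ₜψ(t, r)` of a function on `[0, ∞) × [0, ∞)`
(one-sided at `t = 0`, the usual derivative at `t > 0`). -/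
def timeDeriv (ψ : ℝ → ℝ → ℝ) (t r : ℝ) : ℝ :=
  derivWithin (fun s => ψ s r) (Ici 0) t

/-- The energy `∫₀^∞ (ψ₁² + (∂ᵣψ₀)² + sin²(ψ₀) / r²) r dr` of a pair `(ψ₀, ψ₁)`, as an element of
`[0, ∞]`. -/
def energy (ψ₀ ψ₁ : ℝ → ℝ) : ℝ≥0∞ :=
  ∫⁻ r in Ioi (0 : ℝ),
    ENNReal.ofReal ((ψ₁ r ^ 2 + deriv ψ₀ r ^ 2 + Real.sin (ψ₀ r) ^ 2 / r ^ 2) * r)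

/-- The energy class `ℋₙ = ℋ₀,ₙ`: finite energy, `ψ₀(0) = 0` and `ψ₀(∞) = nπ`. -/
def InEnergyClass (n : ℤ) (ψ₀ ψ₁ : ℝ → ℝ) : Prop :=
  energy ψ₀ ψ₁ < ⊤ ∧ ψ₀ 0 = 0 ∧ Tendsto ψ₀ atTop (𝓝 (n * Real.pi))

/-- The full energy space `ℋ = ⋃ₙ ℋₙ`. -/
def InEnergySpace (ψ₀ ψ₁ : ℝ → ℝ) : Prop :=
  ∃ n : ℤ, InEnergyClass n ψ₀ ψ₁

/-- The square `∫ (g² + (∂ᵣf)² + f² / r²) r dr` over `r ∈ s` of the `H × L²` norm of `(f, g)`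
localized to a set `s` of positive radii, as an element of `[0, ∞]`. -/
def normHL2Sq (s : Set ℝ) (f g : ℝ → ℝ) : ℝ≥0∞ :=
  ∫⁻ r in s, ENNReal.ofReal ((g r ^ 2 + deriv f r ^ 2 + f r ^ 2 / r ^ 2) * r)

/-- The 1-equivariant map `U(t, x) = (sin ψ cos ω, sin ψ sin ω, cos ψ)`, `ψ = ψ(t, |x|)`, into the
unit sphere of `ℝ³`, where `(|x|, ω)` are the polar coordinates of `x ∈ ℝ²`, so that
`cos ω = x₀ / |x|` and `sin ω = x₁ / |x|`. When `ψ(t, 0) = 0`, the value at `x = 0` is the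
north pole. -/
def sphereMap (ψ : ℝ → ℝ → ℝ) (p : ℝ × EuclideanSpace ℝ (Fin 2)) : EuclideanSpace ℝ (Fin 3) :=
  !₂[Real.sin (ψ p.1 ‖p.2‖) * (p.2 0 / ‖p.2‖),
     Real.sin (ψ p.1 ‖p.2‖) * (p.2 1 / ‖p.2‖),
     Real.cos (ψ p.1 ‖p.2‖)]

/-- `ψ(t, r)`, `t ≥ 0`, `r ≥ 0`, is (the polar angle of) a smooth 1-equivariant wave map
`U : [0, ∞) × ℝ² → 𝕊²` which is global in forward time and takes values in the energy space `ℋ`.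
Only the values of `ψ` at `t ≥ 0`, `r ≥ 0` matter. -/
structure IsSmoothGlobal (ψ : ℝ → ℝ → ℝ) : Prop where
  /-- The map into the sphere is smooth, including at `x = 0` and up to `t = 0`. -/
  smooth_map : ContDiffOn ℝ ∞ (sphereMap ψ) (Ici 0 ×ˢ univ)
  /-- The angle `ψ` is the smooth lift of that map. -/
  smooth_angle : ContDiffOn ℝ ∞ (fun p : ℝ × ℝ => ψ p.1 p.2) (Ici 0 ×ˢ Ici 0)
  /-- The equivariant wave map equation `ψₜₜ - ψᵣᵣ - ψᵣ / r + sin(2ψ) / (2r²) = 0`. -/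
  equation : ∀ t r : ℝ, 0 < t → 0 < r →
    deriv (deriv (fun s => ψ s r)) t - deriv (deriv (ψ t)) r - 1 / r * deriv (ψ t) r
      + Real.sin (2 * ψ t r) / (2 * r ^ 2) = 0
  /-- `(ψ(t), ∂ₜψ(t))` lies in the energy space `ℋ` at every time. -/
  energy_space : ∀ t : ℝ, 0 ≤ t → InEnergySpace (ψ t) (timeDeriv ψ t)

end EquivariantWaveMap

end

/-!
Energy conservation says that the one-form `r ψₜ ψᵣ dt + e dr`, with `e` the energy density with
respect to `dr`, is closed on the quadrant `t, r > 0`. Hence it has a primitive `Φ`, which up to a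
constant is the energy in the ball of radius `r` at time `t`. In the null coordinates `ξ = t - r`,
`η = t + r` the derivatives `∂_η Φ ≥ 0` and `-∂_ξ Φ ≥ 0` are the energy fluxes through outgoing and
incoming cones, so `Φ` increases in `η` and decreases in `ξ`. It is bounded, because the energy at
one time is finite and none is lost at the origin (`IsEnergyPotential.bounds`).

By monotonicity `Φ` has limits `F(ξ)` as `η → ∞`, and `F(ξ)` decreases to a limit `L`. The main
point is that `Φ(t, λ t) → L` for `0 < λ < 1`, so that no energy remains in `λ t ≤ r ≤ t - A`
(`IsEnergyPotential.exists_limit`). This follows from the null structure: the mixed derivative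
`∂_ξ ∂_η Φ` is bounded by `C √(∂_η Φ · (-∂_ξ Φ)) / r`. On the outgoing cone `ξ = u`, at
`η ≥ κ u` with `κ > 1`, integration from a fixed earlier cone `ξ = u₀` gives
`∂_η Φ(u, η) ≤ 3 ∂_η Φ(u₀, η) + K u η⁻² (F(u₀) - Φ(u, η))`. As `∫ u η⁻² dη` over `η ≥ κ u` is
bounded independently of `u`, Grönwall's inequality in `η` bounds `F(u₀) - Φ(u, κ u)` by a multiple
of `F(u₀) - L` plus a term that vanishes as `u → ∞` (`exists_null_limit`).

For the angle, the oscillation of `cos ψ` over an annulus is at most the energy of the annulus. This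
controls `ψ` where the energy is small: outside the light cone and in `λ t ≤ r ≤ t - A`. The strip
between these regions has bounded width and large radius, so `ψ` is nearly constant there by
Young's inequality. Once `ψ` is close to `k π`, the term `(ψ - k π)²` in the norm is
comparable to `sin² ψ`, and the norm is controlled by a difference of values of `Φ`.
-/

/-! ### Limits of functions with small mixed null derivative -/

/-- A bound `a' ≤ a / u + K u η⁻² b` along incoming null lines integrates to a bound for the
outgoing flux density `a` in terms of its value on an earlier outgoing line. -/
theorem outgoing_density_le {W a b a' : ℝ → ℝ → ℝ} {C κ u₀ u η F₀ : ℝ} (hκ : 1 < κ)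
    (hu₀ : 0 < u₀) (hu : u₀ ≤ u) (hη : κ * u ≤ η)
    (ha0 : ∀ x y, 0 < x → x < y → 0 ≤ a x y) (hb0 : ∀ x y, 0 < x → x < y → 0 ≤ b x y)
    (hWx : ∀ x y, 0 < x → x < y → HasDerivAt (fun x => W x y) (-b x y) x)
    (hax : ∀ x y, 0 < x → x < y → HasDerivAt (fun x => a x y) (a' x y) x)
    (hab : ∀ x y, 0 < x → x < y → a' x y ^ 2 * (y - x) ^ 2 ≤ C ^ 2 * (a x y * b x y))
    (hF : W u₀ η ≤ F₀) :
    a u η ≤ Real.exp 1 * a u₀ η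
      + Real.exp 1 * (C ^ 2 / (4 * (1 - 1 / κ) ^ 2)) * u / η ^ 2 * (F₀ - W u η) := by
  set K := C ^ 2 / (4 * (1 - 1 / κ) ^ 2) with hK
  have hu' : 0 < u := hu₀.trans_le hu
  have hκ0 : 0 < κ := by linarith
  have huη : u < η := by nlinarith
  have hη0 : 0 < η := by linarith
  have h1κ : 0 < 1 - 1 / κ := by
    rw [sub_pos, div_lt_one hκ0]; exact hκ
  have hK0 : 0 ≤ K := by positivity
  -- The integrating factor stays between `1 / e` and `1` because the weight is `1 / u` on `[0, u]`.
  have hanti : AntitoneOn (fun x => Real.exp (-(x / u)) * a x η + K * u / η ^ 2 * W x η)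
      (Icc u₀ u) := by
    have hd : ∀ x ∈ Icc u₀ u, HasDerivAt
        (fun x => Real.exp (-(x / u)) * a x η + K * u / η ^ 2 * W x η)
        (Real.exp (-(x / u)) * (-(1 / u)) * a x η + Real.exp (-(x / u)) * a' x η
          + K * u / η ^ 2 * (-b x η)) x := by
      intro x hx
      have hx0 : 0 < x := hu₀.trans_le hx.1
      have hxη : x < η := hx.2.trans_lt huη
      exact ((((hasDerivAt_id x).div_const u).neg.exp).mul (hax x η hx0 hxη)).add
        ((hWx x η hx0 hxη).const_mul _)
    refine antitoneOn_of_hasDerivWithinAt_nonpos (convex_Icc _ _)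
      (fun x hx => (hd x hx).continuousAt.continuousWithinAt)
      (fun x hx => (hd x (interior_subset hx)).hasDerivWithinAt) ?_
    intro x hx
    have hx := interior_subset hx
    have hx0 : 0 < x := hu₀.trans_le hx.1
    have hxη : x < η := hx.2.trans_lt huη
    have hA := ha0 x η hx0 hxη
    have hB := hb0 x η hx0 hxη
    have hd0 : 0 < η - x := by linarith
    have hdη : (1 - 1 / κ) * η ≤ η - x := by
      have : x ≤ η / κ := by
        rw [le_div_iff₀ hκ0]; nlinarith [hx.2]
      have h2 : (1 - 1 / κ) * η = η - η / κ := by ring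
      linarith
    have hkey : a' x η ≤ a x η / u + K * u / η ^ 2 * b x η := by
      -- arithmetic-geometric mean, with weights `1 / u` and `u`
      have h1 : a' x η ^ 2 ≤ (a x η / u + C ^ 2 * u / (4 * (η - x) ^ 2) * b x η) ^ 2 := by
        have h2 : a' x η ^ 2 ≤ C ^ 2 * (a x η * b x η) / (η - x) ^ 2 := by
          rw [le_div_iff₀ (by positivity)]; exact hab x η hx0 hxη
        have h3 : C ^ 2 * (a x η * b x η) / (η - x) ^ 2
            = 4 * (a x η / u) * (C ^ 2 * u / (4 * (η - x) ^ 2) * b x η) := by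
          field_simp
        nlinarith [sq_nonneg (a x η / u - C ^ 2 * u / (4 * (η - x) ^ 2) * b x η)]
      have h4 := le_of_abs_le (abs_le_of_sq_le_sq h1 (by positivity))
      have h5 : C ^ 2 * u / (4 * (η - x) ^ 2) ≤ K * u / η ^ 2 := by
        have : K * u / η ^ 2 = C ^ 2 * u / (4 * ((1 - 1 / κ) * η) ^ 2) := by
          rw [hK]; field_simp
        rw [this]
        gcongr
      nlinarith [mul_le_mul_of_nonneg_right h5 hB]
    have he1 : Real.exp (-(x / u)) ≤ 1 := by
      rw [Real.exp_le_one_iff]; have := div_pos hx0 hu'; linarith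
    have he0 := Real.exp_pos (-(x / u))
    have hKb : 0 ≤ K * u / η ^ 2 * b x η := by positivity
    have h6 : a' x η - 1 / u * a x η ≤ K * u / η ^ 2 * b x η := by
      have : 1 / u * a x η = a x η / u := by ring
      linarith
    nlinarith [mul_le_mul_of_nonneg_left h6 he0.le, mul_le_mul_of_nonneg_right he1 hKb]
  have h := hanti (left_mem_Icc.2 hu) (right_mem_Icc.2 hu) hu
  simp only [div_self hu'.ne'] at h
  have hA0 := ha0 u₀ η hu₀ (hu.trans_lt huη)
  have he1 : Real.exp (-(u₀ / u)) ≤ 1 := by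
    rw [Real.exp_le_one_iff]; have := div_pos hu₀ hu'; linarith
  have hKu : 0 ≤ K * u / η ^ 2 := by positivity
  have h2 : Real.exp (-1) * a u η ≤ a u₀ η + K * u / η ^ 2 * (F₀ - W u η) := by
    nlinarith [mul_le_mul_of_nonneg_right he1 hA0, mul_le_mul_of_nonneg_left hF hKu]
  have h3 := mul_le_mul_of_nonneg_left h2 (Real.exp_pos 1).le
  rw [← mul_assoc, ← Real.exp_add] at h3
  norm_num at h3
  calc _ ≤ _ := h3
    _ = _ := by ring

/-- Grönwall's inequality for the flux through the outgoing null line `ξ = u`, run inwards from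
null infinity. -/
theorem outgoing_flux_le {W a b a' : ℝ → ℝ → ℝ} {C κ u₀ u η F₀ : ℝ} (hκ : 1 < κ)
    (hu₀ : 0 < u₀) (hu : u₀ ≤ u) (hη : κ * u ≤ η)
    (ha0 : ∀ x y, 0 < x → x < y → 0 ≤ a x y) (hb0 : ∀ x y, 0 < x → x < y → 0 ≤ b x y)
    (hWx : ∀ x y, 0 < x → x < y → HasDerivAt (fun x => W x y) (-b x y) x)
    (hWy : ∀ x y, 0 < x → x < y → HasDerivAt (fun y => W x y) (a x y) y)
    (hax : ∀ x y, 0 < x → x < y → HasDerivAt (fun x => a x y) (a' x y) x)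
    (hab : ∀ x y, 0 < x → x < y → a' x y ^ 2 * (y - x) ^ 2 ≤ C ^ 2 * (a x y * b x y))
    (hF : ∀ y, u₀ < y → W u₀ y ≤ F₀) (hWF : W u η ≤ F₀) :
    Real.exp (-(Real.exp 1 * (C ^ 2 / (4 * (1 - 1 / κ) ^ 2)) / κ)) * (F₀ - W u (κ * u))
      + Real.exp 1 * W u₀ (κ * u) ≤ F₀ - W u η + Real.exp 1 * F₀ := by
  set K := Real.exp 1 * (C ^ 2 / (4 * (1 - 1 / κ) ^ 2)) with hK
  have hu' : 0 < u := hu₀.trans_le hu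
  have hκ0 : 0 < κ := by linarith
  have huκ : u < κ * u := by nlinarith
  have h1κ : 0 < 1 - 1 / κ := by
    rw [sub_pos, div_lt_one hκ0]; exact hκ
  have hK0 : 0 ≤ K := by positivity
  -- `K u / y²` is integrable at infinity, with primitive `-K u / y`; this is the integrating factor.
  have hmono : MonotoneOn (fun y => Real.exp (-(K * u) * y⁻¹) * (F₀ - W u y)
      + Real.exp 1 * W u₀ y) (Icc (κ * u) η) := by
    have hd : ∀ y ∈ Icc (κ * u) η, HasDerivAt
        (fun y => Real.exp (-(K * u) * y⁻¹) * (F₀ - W u y) + Real.exp 1 * W u₀ y)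
        (Real.exp (-(K * u) * y⁻¹) * (-(K * u) * (-(y ^ 2)⁻¹)) * (F₀ - W u y)
          + Real.exp (-(K * u) * y⁻¹) * (-a u y) + Real.exp 1 * a u₀ y) y := by
      intro y hy
      have huy : u < y := huκ.trans_le hy.1
      have hy0 : y ≠ 0 := by linarith
      exact ((((hasDerivAt_inv hy0).const_mul (-(K * u))).exp).mul
        ((hWy u y hu' huy).const_sub F₀)).add
        ((hWy u₀ y hu₀ (hu.trans_lt huy)).const_mul _)
    refine monotoneOn_of_hasDerivWithinAt_nonneg (convex_Icc _ _)
      (fun x hx => (hd x hx).continuousAt.continuousWithinAt)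
      (fun x hx => (hd x (interior_subset hx)).hasDerivWithinAt) ?_
    intro y hy
    have hy := interior_subset hy
    have huy : u < y := huκ.trans_le hy.1
    have hy0 : 0 < y := by linarith
    have h1 := outgoing_density_le hκ hu₀ hu hy.1 ha0 hb0 hWx hax hab
      (hF y (hu.trans_lt huy))
    rw [← hK] at h1
    have he0 := Real.exp_pos (-(K * u) * y⁻¹)
    have he1 : Real.exp (-(K * u) * y⁻¹) ≤ 1 := by
      rw [Real.exp_le_one_iff]
      have : 0 ≤ K * u * y⁻¹ := by positivity
      linarith
    have hA : 0 ≤ Real.exp 1 * a u₀ y :=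
      mul_nonneg (Real.exp_pos 1).le (ha0 u₀ y hu₀ (hu.trans_lt huy))
    have h2 : K * u / y ^ 2 * (F₀ - W u y) = K * u * (y ^ 2)⁻¹ * (F₀ - W u y) := by
      rw [div_eq_mul_inv]
    nlinarith [mul_le_mul_of_nonneg_left h1 he0.le, mul_le_mul_of_nonneg_right he1 hA]
  have h := hmono (left_mem_Icc.2 hη) (right_mem_Icc.2 hη) hη
  simp only at h
  have e1 : -(K * u) * (κ * u)⁻¹ = -(K / κ) := by
    field_simp
  rw [e1] at h
  have he1 : Real.exp (-(K * u) * η⁻¹) ≤ 1 := by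
    rw [Real.exp_le_one_iff]
    have : 0 < η := by linarith
    have : 0 ≤ K * u * η⁻¹ := by positivity
    linarith
  have h3 : W u₀ η ≤ F₀ := hF η (by linarith)
  nlinarith [mul_le_mul_of_nonneg_right he1 (sub_nonneg.2 hWF),
    mul_le_mul_of_nonneg_left h3 (Real.exp_pos 1).le]

/-- A bounded function `W(ξ, η)` which increases in `η`, decreases in `ξ` and whose mixed derivative
is controlled by the geometric mean of the two fluxes over `η - ξ` converges along every ray
`η = κ ξ`, `κ > 1`, to the same limit: the limit as `ξ → ∞` of its values at `η = ∞`. Here `F ξ` is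
the supremum over `η`, the value at null infinity. -/
theorem exists_null_limit {W a b a' : ℝ → ℝ → ℝ} {C m M : ℝ}
    (ha0 : ∀ x y, 0 < x → x < y → 0 ≤ a x y) (hb0 : ∀ x y, 0 < x → x < y → 0 ≤ b x y)
    (hWx : ∀ x y, 0 < x → x < y → HasDerivAt (fun x => W x y) (-b x y) x)
    (hWy : ∀ x y, 0 < x → x < y → HasDerivAt (fun y => W x y) (a x y) y)
    (hax : ∀ x y, 0 < x → x < y → HasDerivAt (fun x => a x y) (a' x y) x)
    (hab : ∀ x y, 0 < x → x < y → a' x y ^ 2 * (y - x) ^ 2 ≤ C ^ 2 * (a x y * b x y))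
    (hm : ∀ x y, 0 < x → x < y → m ≤ W x y) (hM : ∀ x y, 0 < x → x < y → W x y ≤ M) :
    ∃ (F : ℝ → ℝ) (L : ℝ), (∀ x y, 0 < x → x < y → W x y ≤ F x) ∧ Tendsto F atTop (𝓝 L) ∧
      ∀ κ, 1 < κ → Tendsto (fun u => W u (κ * u)) atTop (𝓝 L) := by
  have hmonoy : ∀ x, 0 < x → MonotoneOn (W x) (Ioi x) := fun x hx =>
    monotoneOn_of_hasDerivWithinAt_nonneg (convex_Ioi _)
      (fun y hy => (hWy x y hx hy).continuousAt.continuousWithinAt)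
      (fun y hy => (hWy x y hx (interior_subset hy)).hasDerivWithinAt)
      (fun y hy => ha0 x y hx (interior_subset hy))
  have hantix : ∀ y, AntitoneOn (fun x => W x y) (Ioo 0 y) := fun y =>
    antitoneOn_of_hasDerivWithinAt_nonpos (convex_Ioo _ _)
      (fun x hx => (hWx x y hx.1 hx.2).continuousAt.continuousWithinAt)
      (fun x hx => (hWx x y (interior_subset hx).1 (interior_subset hx).2).hasDerivWithinAt)
      (fun x hx => by
        have := hb0 x y (interior_subset hx).1 (interior_subset hx).2
        linarith)
  have hlub : ∀ x, ∃ s, 0 < x → IsLUB (W x '' Ioi x) s := by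
    intro x
    by_cases hx : 0 < x
    · obtain ⟨s, hs⟩ := Real.exists_isLUB (s := W x '' Ioi x) (nonempty_Ioi.image _)
        ⟨M, by rintro _ ⟨y, hy, rfl⟩; exact hM x y hx hy⟩
      exact ⟨s, fun _ => hs⟩
    · exact ⟨0, fun h => absurd h hx⟩
  choose F hF using hlub
  have hWF : ∀ x y, 0 < x → x < y → W x y ≤ F x := fun x y hx hy => (hF x hx).1 ⟨y, hy, rfl⟩
  have hFanti : ∀ x x', 0 < x → x ≤ x' → F x' ≤ F x := by
    intro x x' hx hxx'
    refine (hF x' (hx.trans_le hxx')).2 ?_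
    rintro _ ⟨y, hy, rfl⟩
    exact (hantix y ⟨hx, hxx'.trans_lt hy⟩ ⟨hx.trans_le hxx', hy⟩ hxx').trans
      (hWF x y hx (hxx'.trans_lt hy))
  obtain ⟨L, hL⟩ := Real.exists_isGLB (s := F '' Ioi 0) (nonempty_Ioi.image _)
    ⟨m, by
      rintro _ ⟨x, hx, rfl⟩
      exact (hm x (x + 1) hx (by linarith)).trans (hWF x (x + 1) hx (by linarith))⟩
  have hLF : ∀ x, 0 < x → L ≤ F x := fun x hx => hL.1 ⟨x, hx, rfl⟩
  have hFL : ∀ ε > 0, ∃ x, 0 < x ∧ F x < L + ε := by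
    intro ε hε
    obtain ⟨_, ⟨x, hx, rfl⟩, -, h⟩ := hL.exists_between (show L < L + ε by linarith)
    exact ⟨x, hx, h⟩
  have hFlim : Tendsto F atTop (𝓝 L) := by
    rw [Metric.tendsto_atTop]
    intro ε hε
    obtain ⟨x, hx, h⟩ := hFL ε hε
    refine ⟨x, fun y hy => ?_⟩
    rw [Real.dist_eq, abs_lt]
    constructor <;> linarith [hFanti x y hx hy, hLF y (hx.trans_le hy)]
  refine ⟨F, L, hWF, hFlim, fun κ hκ => ?_⟩
  have hκ0 : 0 < κ := by linarith
  set D := Real.exp (Real.exp 1 * (C ^ 2 / (4 * (1 - 1 / κ) ^ 2)) / κ) with hD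
  have hD0 : 0 < D := Real.exp_pos _
  have hflux : ∀ u₀ u, 0 < u₀ → u₀ ≤ u →
      F u₀ - W u (κ * u) ≤ D * (F u₀ - L + Real.exp 1 * (F u₀ - W u₀ (κ * u))) := by
    intro u₀ u hu₀ hu
    have hu' : 0 < u := hu₀.trans_le hu
    have huκ : u < κ * u := by nlinarith
    set G := Real.exp (-(Real.exp 1 * (C ^ 2 / (4 * (1 - 1 / κ) ^ 2)) / κ)) *
        (F u₀ - W u (κ * u)) + Real.exp 1 * W u₀ (κ * u) with hG
    have h1 : F u ≤ F u₀ + Real.exp 1 * F u₀ - G := by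
      refine (hF u hu').2 ?_
      have hgt : ∀ η, κ * u ≤ η → W u η ≤ F u₀ + Real.exp 1 * F u₀ - G := by
        intro η hη
        have := outgoing_flux_le hκ hu₀ hu hη ha0 hb0 hWx hWy hax hab
          (fun y hy => hWF u₀ y hu₀ hy)
          ((hWF u η hu' (huκ.trans_le hη)).trans (hFanti u₀ u hu₀ hu))
        linarith
      rintro _ ⟨y, hy, rfl⟩
      rcases le_total (κ * u) y with h | h
      · exact hgt y h
      · exact (hmonoy u hu' hy huκ h).trans (hgt _ le_rfl)
    have h2 : D⁻¹ * (F u₀ - W u (κ * u)) ≤ F u₀ - L + Real.exp 1 * (F u₀ - W u₀ (κ * u)) := by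
      rw [hD, ← Real.exp_neg]
      linarith [hLF u hu']
    rwa [inv_mul_le_iff₀ hD0] at h2
  rw [Metric.tendsto_atTop]
  intro ε hε
  obtain ⟨N, hN⟩ := (Metric.tendsto_atTop.1 hFlim) ε hε
  -- The two terms `F u₀ - L` and `F u₀ - W u₀ (κ * u)` on the right of `hflux` are made small by
  -- taking `u₀` large and then `u` large.
  set ε' := ε / (2 * D * (1 + Real.exp 1)) with hε'
  have hε'0 : 0 < ε' := by positivity
  obtain ⟨u₀, hu₀, hFu₀⟩ := hFL ε' hε'0
  obtain ⟨_, ⟨y₀, hy₀, rfl⟩, hWy₀, -⟩ := (hF u₀ hu₀).exists_between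
    (show F u₀ - ε' < F u₀ by linarith)
  refine ⟨max (max N u₀) y₀, fun u hu => ?_⟩
  simp only [ge_iff_le, max_le_iff] at hu
  obtain ⟨⟨huN, huu₀⟩, huy₀⟩ := hu
  have hu' : 0 < u := hu₀.trans_le huu₀
  have huκ : u < κ * u := by nlinarith
  have h1 := hN u huN
  rw [Real.dist_eq, abs_lt] at h1 ⊢
  have h2 := hWF u (κ * u) hu' huκ
  have h3 := hflux u₀ u hu₀ huu₀
  have h4 := hmonoy u₀ hu₀ hy₀ (show κ * u ∈ Ioi u₀ from huu₀.trans_lt huκ)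
    (huy₀.trans huκ.le)
  have h5 : F u₀ - L + Real.exp 1 * (F u₀ - W u₀ (κ * u)) ≤ ε' * (1 + Real.exp 1) := by
    nlinarith [Real.exp_pos 1]
  have h6 := mul_le_mul_of_nonneg_left h5 hD0.le
  have h7 : D * (ε' * (1 + Real.exp 1)) = ε / 2 := by
    rw [hε']
    have := Real.exp_pos 1
    field_simp
  constructor <;> linarith [hLF u₀ hu₀]

noncomputable section

namespace EquivariantWaveMap

/-! ### Derivatives of the angle -/

/-- The open quadrant `t > 0`, `r > 0`, where `ψ` is a classical solution. -/
def quadrant : Set (ℝ × ℝ) := Ioi 0 ×ˢ Ioi 0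

/-- The partial derivative `∂ₜψ`, as a function on the plane. -/
def partialT (ψ : ℝ → ℝ → ℝ) (p : ℝ × ℝ) : ℝ :=
  fderiv ℝ (fun p : ℝ × ℝ => ψ p.1 p.2) p (1, 0)

/-- The partial derivative `∂ᵣψ`, as a function on the plane. -/
def partialR (ψ : ℝ → ℝ → ℝ) (p : ℝ × ℝ) : ℝ :=
  fderiv ℝ (fun p : ℝ × ℝ => ψ p.1 p.2) p (0, 1)

/-- The energy density `r (ψₜ² + ψᵣ² + sin² ψ / r²) / 2` with respect to `dr`. -/
def energyDensity (ψ : ℝ → ℝ → ℝ) (p : ℝ × ℝ) : ℝ :=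
  p.2 / 2 * (partialT ψ p ^ 2 + partialR ψ p ^ 2) + Real.sin (ψ p.1 p.2) ^ 2 / (2 * p.2)

/-- The radial energy flux `r ψₜ ψᵣ`. -/
def energyFlux (ψ : ℝ → ℝ → ℝ) (p : ℝ × ℝ) : ℝ :=
  p.2 * partialT ψ p * partialR ψ p

/-- The energy one-form `r ψₜ ψᵣ dt + e dr`, which is closed because energy is conserved. -/
def energyForm (ψ : ℝ → ℝ → ℝ) (p : ℝ × ℝ) : ℝ × ℝ →L[ℝ] ℝ :=
  energyFlux ψ p • ContinuousLinearMap.fst ℝ ℝ ℝ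
    + energyDensity ψ p • ContinuousLinearMap.snd ℝ ℝ ℝ

/-- A primitive of the energy one-form on the quadrant. Up to a constant, `Φ (t, r)` is the energy
at time `t` inside the ball of radius `r`. -/
def IsEnergyPotential (ψ : ℝ → ℝ → ℝ) (Φ : ℝ × ℝ → ℝ) : Prop :=
  ∀ p ∈ quadrant, HasFDerivAt Φ (energyForm ψ p) p

theorem isOpen_quadrant : IsOpen quadrant := isOpen_Ioi.prod isOpen_Ioi

theorem convex_quadrant : Convex ℝ quadrant := (convex_Ioi 0).prod (convex_Ioi 0)

theorem mk_mem_quadrant {t r : ℝ} (ht : 0 < t) (hr : 0 < r) : (t, r) ∈ quadrant := ⟨ht, hr⟩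

variable {ψ : ℝ → ℝ → ℝ}

theorem IsSmoothGlobal.contDiffAt (hψ : IsSmoothGlobal ψ) {p : ℝ × ℝ} (hp : p ∈ quadrant) :
    ContDiffAt ℝ ∞ (fun p : ℝ × ℝ => ψ p.1 p.2) p :=
  hψ.smooth_angle.contDiffAt (mem_of_superset (isOpen_quadrant.mem_nhds hp)
    (prod_mono Ioi_subset_Ici_self Ioi_subset_Ici_self))

/-- A linear form on the plane is determined by its two coefficients. -/
theorem clm_eq_smul_fst_add_smul_snd (l : ℝ × ℝ →L[ℝ] ℝ) :
    l = l (1, 0) • ContinuousLinearMap.fst ℝ ℝ ℝ + l (0, 1) • ContinuousLinearMap.snd ℝ ℝ ℝ := by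
  ext <;> simp

theorem IsSmoothGlobal.hasFDerivAt (hψ : IsSmoothGlobal ψ) {p : ℝ × ℝ} (hp : p ∈ quadrant) :
    HasFDerivAt (fun p : ℝ × ℝ => ψ p.1 p.2)
      (partialT ψ p • ContinuousLinearMap.fst ℝ ℝ ℝ
        + partialR ψ p • ContinuousLinearMap.snd ℝ ℝ ℝ) p := by
  have h := ((hψ.contDiffAt hp).differentiableAt (by simp)).hasFDerivAt
  rw [clm_eq_smul_fst_add_smul_snd (fderiv ℝ _ p)] at h
  exact h

theorem hasDerivAt_slice_left {f : ℝ × ℝ → ℝ} {α β t r : ℝ}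
    (h : HasFDerivAt f (α • ContinuousLinearMap.fst ℝ ℝ ℝ
      + β • ContinuousLinearMap.snd ℝ ℝ ℝ) (t, r)) :
    HasDerivAt (fun s => f (s, r)) α t :=
  (h.comp_hasDerivAt t ((hasDerivAt_id t).prodMk (hasDerivAt_const t r))).congr_deriv
    (by simp)

theorem hasDerivAt_slice_right {f : ℝ × ℝ → ℝ} {α β t r : ℝ}
    (h : HasFDerivAt f (α • ContinuousLinearMap.fst ℝ ℝ ℝ
      + β • ContinuousLinearMap.snd ℝ ℝ ℝ) (t, r)) :
    HasDerivAt (fun s => f (t, s)) β r :=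
  (h.comp_hasDerivAt r ((hasDerivAt_const r t).prodMk (hasDerivAt_id r))).congr_deriv
    (by simp)

theorem IsSmoothGlobal.hasDerivAt_time (hψ : IsSmoothGlobal ψ) {t r : ℝ} (ht : 0 < t)
    (hr : 0 < r) : HasDerivAt (fun s => ψ s r) (partialT ψ (t, r)) t :=
  hasDerivAt_slice_left (f := fun p : ℝ × ℝ => ψ p.1 p.2) (hψ.hasFDerivAt (mk_mem_quadrant ht hr))

theorem IsSmoothGlobal.hasDerivAt_radius (hψ : IsSmoothGlobal ψ) {t r : ℝ} (ht : 0 < t)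
    (hr : 0 < r) : HasDerivAt (ψ t) (partialR ψ (t, r)) r :=
  hasDerivAt_slice_right (f := fun p : ℝ × ℝ => ψ p.1 p.2) (hψ.hasFDerivAt (mk_mem_quadrant ht hr))

theorem IsSmoothGlobal.timeDeriv_eq (hψ : IsSmoothGlobal ψ) {t r : ℝ} (ht : 0 < t)
    (hr : 0 < r) : timeDeriv ψ t r = partialT ψ (t, r) := by
  rw [timeDeriv, derivWithin_of_mem_nhds (Ici_mem_nhds ht), (hψ.hasDerivAt_time ht hr).deriv]

/-- The second order derivatives of `ψ`, with the wave map equation multiplied by `r²`. -/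
theorem IsSmoothGlobal.exists_second_derivatives (hψ : IsSmoothGlobal ψ) {p : ℝ × ℝ}
    (hp : p ∈ quadrant) : ∃ ftt ftr frr : ℝ,
      HasFDerivAt (partialT ψ) (ftt • ContinuousLinearMap.fst ℝ ℝ ℝ
        + ftr • ContinuousLinearMap.snd ℝ ℝ ℝ) p ∧
      HasFDerivAt (partialR ψ) (ftr • ContinuousLinearMap.fst ℝ ℝ ℝ
        + frr • ContinuousLinearMap.snd ℝ ℝ ℝ) p ∧
      p.2 ^ 2 * (ftt - frr) = p.2 * partialR ψ p
        - Real.sin (ψ p.1 p.2) * Real.cos (ψ p.1 p.2) := by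
  have hc := hψ.contDiffAt hp
  set D := fderiv ℝ (fderiv ℝ (fun p : ℝ × ℝ => ψ p.1 p.2)) p with hD
  have hd : HasFDerivAt (fderiv ℝ (fun p : ℝ × ℝ => ψ p.1 p.2)) D p :=
    ((hc.fderiv_right (m := ∞) (by simp)).differentiableAt (by simp)).hasFDerivAt
  have hsymm : D (0, 1) (1, 0) = D (1, 0) (0, 1) :=
    (hc.isSymmSndFDerivAt (by
      rw [minSmoothness_of_isRCLikeNormedField]
      exact WithTop.coe_le_coe.2 le_top)) (0, 1) (1, 0)
  have hT : HasFDerivAt (partialT ψ) (D (1, 0) (1, 0) • ContinuousLinearMap.fst ℝ ℝ ℝ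
        + D (1, 0) (0, 1) • ContinuousLinearMap.snd ℝ ℝ ℝ) p := by
    refine HasFDerivAt.congr_fderiv (f := partialT ψ)
      (hd.clm_apply (hasFDerivAt_const ((1, 0) : ℝ × ℝ) p)) ?_
    ext <;> simp [hsymm]
  have hR : HasFDerivAt (partialR ψ) (D (1, 0) (0, 1) • ContinuousLinearMap.fst ℝ ℝ ℝ
        + D (0, 1) (0, 1) • ContinuousLinearMap.snd ℝ ℝ ℝ) p := by
    refine HasFDerivAt.congr_fderiv (f := partialR ψ)
      (hd.clm_apply (hasFDerivAt_const ((0, 1) : ℝ × ℝ) p)) ?_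
    ext <;> simp
  refine ⟨D (1, 0) (1, 0), D (1, 0) (0, 1), D (0, 1) (0, 1), hT, hR, ?_⟩
  obtain ⟨t, r⟩ := p
  have ht : 0 < t := hp.1
  have hr : 0 < r := hp.2
  have he := hψ.equation t r ht hr
  have h1 : deriv (fun s => ψ s r) =ᶠ[𝓝 t] fun s => partialT ψ (s, r) := by
    filter_upwards [Ioi_mem_nhds ht] with s hs using (hψ.hasDerivAt_time hs hr).deriv
  have h2 : deriv (ψ t) =ᶠ[𝓝 r] fun s => partialR ψ (t, s) := by
    filter_upwards [Ioi_mem_nhds hr] with s hs using (hψ.hasDerivAt_radius ht hs).deriv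
  rw [h1.deriv_eq, h2.deriv_eq, (hasDerivAt_slice_left hT).deriv,
    (hasDerivAt_slice_right hR).deriv, (hψ.hasDerivAt_radius ht hr).deriv,
    Real.sin_two_mul] at he
  field_simp at he
  simp only
  linarith

/-! ### Conservation of energy -/

/-- The derivatives of the energy density and of the energy flux. The shared coefficient `δ` is
energy conservation `∂ₜe = ∂ᵣ(r ψₜ ψᵣ)`; the last identity is the momentum balance, in which the
second order derivatives cancel. -/
theorem IsSmoothGlobal.hasFDerivAt_energy (hψ : IsSmoothGlobal ψ) {p : ℝ × ℝ}
    (hp : p ∈ quadrant) : ∃ α δ β : ℝ,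
      HasFDerivAt (energyFlux ψ) (α • ContinuousLinearMap.fst ℝ ℝ ℝ
        + δ • ContinuousLinearMap.snd ℝ ℝ ℝ) p ∧
      HasFDerivAt (energyDensity ψ) (δ • ContinuousLinearMap.fst ℝ ℝ ℝ
        + β • ContinuousLinearMap.snd ℝ ℝ ℝ) p ∧
      α - β = (partialR ψ p ^ 2 - partialT ψ p ^ 2) / 2
        - 2 * (Real.sin (ψ p.1 p.2) / p.2) * Real.cos (ψ p.1 p.2) * partialR ψ p
        + (Real.sin (ψ p.1 p.2) / p.2) ^ 2 / 2 := by
  obtain ⟨ftt, ftr, frr, hT, hR, heq⟩ := hψ.exists_second_derivatives hp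
  have hr : p.2 ≠ 0 := ne_of_gt hp.2
  have hf := hψ.hasFDerivAt hp
  have hs : HasFDerivAt (fun p : ℝ × ℝ => p.2) (ContinuousLinearMap.snd ℝ ℝ ℝ) p :=
    hasFDerivAt_snd
  have hftt : ftt = frr + (p.2 * partialR ψ p
        - Real.sin (ψ p.1 p.2) * Real.cos (ψ p.1 p.2)) / p.2 ^ 2 := by
    field_simp
    linarith
  refine ⟨p.2 * (ftt * partialR ψ p + partialT ψ p * ftr),
    partialT ψ p * partialR ψ p + p.2 * (ftr * partialR ψ p + partialT ψ p * frr),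
    (partialT ψ p ^ 2 + partialR ψ p ^ 2) / 2 + p.2 * (partialT ψ p * ftr + partialR ψ p * frr)
      + Real.sin (ψ p.1 p.2) * Real.cos (ψ p.1 p.2) * partialR ψ p / p.2
      - Real.sin (ψ p.1 p.2) ^ 2 / (2 * p.2 ^ 2), ?_, ?_, ?_⟩
  · refine HasFDerivAt.congr_fderiv (f := energyFlux ψ) ((hs.mul hT).mul hR) ?_
    ext <;> simp <;> ring
  · refine HasFDerivAt.congr_fderiv (f := energyDensity ψ)
      (((hs.mul_const 2⁻¹).mul ((hT.pow 2).add (hR.pow 2))).add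
        ((hf.sin.pow 2).mul ((hasDerivAt_inv (by simpa using hr)).comp_hasFDerivAt p
          (hs.const_mul 2)))) ?_
    ext
    · simp
      rw [hftt]; field_simp; ring
    · simp
      field_simp; ring
  · rw [hftt]; field_simp; ring

theorem IsSmoothGlobal.exists_energyPotential (hψ : IsSmoothGlobal ψ) :
    ∃ Φ, IsEnergyPotential ψ Φ := by
  have hform : ∀ p ∈ quadrant, ∃ α δ β : ℝ, HasFDerivAt (energyForm ψ)
      ((α • ContinuousLinearMap.fst ℝ ℝ ℝ + δ • ContinuousLinearMap.snd ℝ ℝ ℝ).smulRight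
          (ContinuousLinearMap.fst ℝ ℝ ℝ)
        + (δ • ContinuousLinearMap.fst ℝ ℝ ℝ + β • ContinuousLinearMap.snd ℝ ℝ ℝ).smulRight
          (ContinuousLinearMap.snd ℝ ℝ ℝ)) p := by
    intro p hp
    obtain ⟨α, δ, β, hQ, hP, -⟩ := hψ.hasFDerivAt_energy hp
    have h1 := hQ.smul_const (ContinuousLinearMap.fst ℝ ℝ ℝ)
    have h2 := hP.smul_const (ContinuousLinearMap.snd ℝ ℝ ℝ)
    exact ⟨α, δ, β, h1.add h2⟩
  refine convex_quadrant.exists_forall_hasFDerivAt_of_fderiv_symmetric isOpen_quadrant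
    (fun p hp => ?_) (fun p hp x y => ?_)
  · obtain ⟨α, δ, β, h⟩ := hform p hp
    exact h.differentiableAt.differentiableWithinAt
  · obtain ⟨α, δ, β, h⟩ := hform p hp
    rw [h.fderiv]
    simp
    ring

/-! ### Pointwise bounds by the energy density -/

theorem abs_energyFlux_le {p : ℝ × ℝ} (hp : p ∈ quadrant) :
    |energyFlux ψ p| ≤ energyDensity ψ p := by
  have hr : 0 < p.2 := hp.2
  have h : 0 ≤ Real.sin (ψ p.1 p.2) ^ 2 / (2 * p.2) := by positivity
  rw [abs_le, energyFlux, energyDensity]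
  constructor <;> nlinarith [mul_nonneg hr.le (sq_nonneg (partialT ψ p + partialR ψ p)),
    mul_nonneg hr.le (sq_nonneg (partialT ψ p - partialR ψ p))]

theorem energyDensity_nonneg {p : ℝ × ℝ} (hp : p ∈ quadrant) : 0 ≤ energyDensity ψ p :=
  (abs_nonneg _).trans (abs_energyFlux_le hp)

theorem abs_sin_mul_partialR_le {p : ℝ × ℝ} (hp : p ∈ quadrant) :
    |Real.sin (ψ p.1 p.2) * partialR ψ p| ≤ energyDensity ψ p := by
  have hr : 0 < p.2 := hp.2
  have h : energyDensity ψ p = p.2 / 2 * (partialT ψ p ^ 2)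
      + p.2 / 2 * (partialR ψ p ^ 2 + (Real.sin (ψ p.1 p.2) / p.2) ^ 2) := by
    rw [energyDensity]; field_simp; ring
  have h2 : Real.sin (ψ p.1 p.2) * partialR ψ p
      = p.2 * ((Real.sin (ψ p.1 p.2) / p.2) * partialR ψ p) := by field_simp
  rw [h, h2]
  set σ := Real.sin (ψ p.1 p.2) / p.2
  have h3 : 0 ≤ p.2 / 2 * partialT ψ p ^ 2 := by positivity
  rw [abs_le]
  constructor <;> nlinarith [mul_nonneg hr.le (sq_nonneg (partialR ψ p + σ)),
    mul_nonneg hr.le (sq_nonneg (partialR ψ p - σ))]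

/-- Young's inequality `|ψᵣ| ≤ σ / 2 + ψᵣ² / (2 σ)`, with `ψᵣ²` bounded by the energy density. -/
theorem abs_partialR_le {p : ℝ × ℝ} (hp : p ∈ quadrant) {σ : ℝ} (hσ : 0 < σ) :
    |partialR ψ p| ≤ σ / 2 + energyDensity ψ p / (σ * p.2) := by
  have hr : 0 < p.2 := hp.2
  have h1 : p.2 / 2 * partialR ψ p ^ 2 ≤ energyDensity ψ p := by
    have h : 0 ≤ Real.sin (ψ p.1 p.2) ^ 2 / (2 * p.2) := by positivity
    have h' : 0 ≤ p.2 / 2 * partialT ψ p ^ 2 := by positivity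
    rw [energyDensity]; linarith
  have h2 : p.2 / 2 * partialR ψ p ^ 2 / (σ * p.2) ≤ energyDensity ψ p / (σ * p.2) := by
    gcongr
  have h3 : p.2 / 2 * partialR ψ p ^ 2 / (σ * p.2) = partialR ψ p ^ 2 / (2 * σ) := by
    field_simp
  have h4 : |partialR ψ p| ≤ σ / 2 + partialR ψ p ^ 2 / (2 * σ) := by
    rw [← sq_abs (partialR ψ p), ← sub_nonneg]
    have : σ / 2 + |partialR ψ p| ^ 2 / (2 * σ) - |partialR ψ p|
      = (σ - |partialR ψ p|) ^ 2 / (2 * σ) := by field_simp; ring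
    rw [this]; positivity
  linarith

variable {Φ : ℝ × ℝ → ℝ}

/-! ### Monotonicity and bounds for the energy potential -/

theorem IsEnergyPotential.hasFDerivAt (hΦ : IsEnergyPotential ψ Φ) {p : ℝ × ℝ}
    (hp : p ∈ quadrant) : HasFDerivAt Φ (energyFlux ψ p • ContinuousLinearMap.fst ℝ ℝ ℝ
      + energyDensity ψ p • ContinuousLinearMap.snd ℝ ℝ ℝ) p := hΦ p hp

theorem hasDerivAt_along_line {f : ℝ × ℝ → ℝ} {α β t r v w s : ℝ}
    (h : HasFDerivAt f (α • ContinuousLinearMap.fst ℝ ℝ ℝ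
      + β • ContinuousLinearMap.snd ℝ ℝ ℝ) (t + v * s, r + w * s)) :
    HasDerivAt (fun s => f (t + v * s, r + w * s)) (α * v + β * w) s :=
  (h.comp_hasDerivAt s ((((hasDerivAt_id s).const_mul v).const_add t).prodMk
    (((hasDerivAt_id s).const_mul w).const_add r))).congr_deriv (by simp)

/-- The potential increases along directions `(v, 1)` with `|v| ≤ 1`, in which the flux through the
boundary of the ball is outweighed by the energy that the ball gains. -/
theorem IsEnergyPotential.le_of_cone (hΦ : IsEnergyPotential ψ Φ) {p q : ℝ × ℝ}
    (hp : p ∈ quadrant) (hq : q ∈ quadrant) (hpq : |q.1 - p.1| ≤ q.2 - p.2) : Φ p ≤ Φ q := by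
  have hmem : ∀ s ∈ Icc (0 : ℝ) 1,
      (p.1 + (q.1 - p.1) * s, p.2 + (q.2 - p.2) * s) ∈ quadrant := by
    intro s hs
    have h := convex_quadrant hp hq (sub_nonneg.2 hs.2) hs.1 (by ring)
    convert h using 1
    ext <;> simp <;> ring
  have hd := fun s hs => hasDerivAt_along_line (hΦ.hasFDerivAt (hmem s hs))
  have hmono := monotoneOn_of_hasDerivWithinAt_nonneg (convex_Icc (0 : ℝ) 1)
    (fun s hs => (hd s hs).continuousAt.continuousWithinAt)
    (fun s hs => (hd s (interior_subset hs)).hasDerivWithinAt)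
    (fun s hs => by
      have h1 := abs_energyFlux_le (ψ := ψ) (hmem s (interior_subset hs))
      have h2 := mul_le_mul h1 hpq (abs_nonneg _) ((abs_nonneg _).trans h1)
      rw [← abs_mul] at h2
      have := neg_abs_le (energyFlux ψ (p.1 + (q.1 - p.1) * s, p.2 + (q.2 - p.2) * s)
        * (q.1 - p.1))
      linarith)
  have h := hmono (left_mem_Icc.2 zero_le_one) (right_mem_Icc.2 zero_le_one) zero_le_one
  simpa using h

theorem IsEnergyPotential.hasDerivAt_radius (hΦ : IsEnergyPotential ψ Φ) {t r : ℝ} (ht : 0 < t)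
    (hr : 0 < r) : HasDerivAt (fun s => Φ (t, s)) (energyDensity ψ (t, r)) r :=
  hasDerivAt_slice_right (hΦ.hasFDerivAt (mk_mem_quadrant ht hr))

theorem IsEnergyPotential.mono_radius (hΦ : IsEnergyPotential ψ Φ) {t r r' : ℝ} (ht : 0 < t)
    (hr : 0 < r) (h : r ≤ r') : Φ (t, r) ≤ Φ (t, r') :=
  hΦ.le_of_cone (mk_mem_quadrant ht hr) (mk_mem_quadrant ht (hr.trans_le h)) (by simpa using h)

theorem IsSmoothGlobal.continuousAt_energyDensity (hψ : IsSmoothGlobal ψ) {t r : ℝ} (ht : 0 < t)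
    (hr : 0 < r) : ContinuousAt (fun s => energyDensity ψ (t, s)) r := by
  obtain ⟨α, δ, β, -, h, -⟩ := hψ.hasFDerivAt_energy (mk_mem_quadrant ht hr)
  exact (hasDerivAt_slice_right h).continuousAt

/-- Differences of the potential in `r` are energies of annuli. -/
theorem IsEnergyPotential.lintegral_energyDensity (hψ : IsSmoothGlobal ψ)
    (hΦ : IsEnergyPotential ψ Φ) {t a b : ℝ} (ht : 0 < t) (ha : 0 < a) (hab : a ≤ b) :
    ∫⁻ r in Icc a b, ENNReal.ofReal (energyDensity ψ (t, r))
      = ENNReal.ofReal (Φ (t, b) - Φ (t, a)) := by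
  have hpos : ∀ r ∈ Icc a b, 0 < r := fun r hr => ha.trans_le hr.1
  have hcont : ContinuousOn (fun r => energyDensity ψ (t, r)) (Icc a b) := fun r hr =>
    (hψ.continuousAt_energyDensity ht (hpos r hr)).continuousWithinAt
  have hint : IntegrableOn (fun r => energyDensity ψ (t, r)) (Icc a b) :=
    hcont.integrableOn_compact isCompact_Icc
  rw [← ofReal_integral_eq_lintegral_ofReal hint ((ae_restrict_iff' measurableSet_Icc).2
      (ae_of_all _ fun r hr => energyDensity_nonneg (mk_mem_quadrant ht (hpos r hr)))),
    integral_Icc_eq_integral_Ioc, ← intervalIntegral.integral_of_le hab,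
    intervalIntegral.integral_eq_sub_of_hasDerivAt (f := fun r => Φ (t, r))]
  · intro r hr
    rw [uIcc_of_le hab] at hr
    exact hΦ.hasDerivAt_radius ht (hpos r hr)
  · exact (hcont.mono (by rw [uIcc_of_le hab])).intervalIntegrable

theorem IsEnergyPotential.sub_le_energy (hψ : IsSmoothGlobal ψ) (hΦ : IsEnergyPotential ψ Φ)
    {t : ℝ} (ht : 0 < t) : ∃ E : ℝ, ∀ a b, 0 < a → a ≤ b → Φ (t, b) - Φ (t, a) ≤ E := by
  obtain ⟨n, hE, -⟩ := hψ.energy_space t ht.le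
  refine ⟨(energy (ψ t) (timeDeriv ψ t)).toReal, fun a b ha hab => ?_⟩
  rw [← ENNReal.ofReal_le_iff_le_toReal hE.ne,
    ← IsEnergyPotential.lintegral_energyDensity hψ hΦ ht ha hab, energy]
  have hsub : Icc a b ⊆ Ioi 0 := fun r hr => ha.trans_le hr.1
  refine le_trans (setLIntegral_mono' measurableSet_Icc fun r hr => ?_)
    (lintegral_mono_set hsub)
  have hr : 0 < r := hsub hr
  refine ENNReal.ofReal_le_ofReal ?_
  rw [hψ.timeDeriv_eq ht hr, (hψ.hasDerivAt_radius ht hr).deriv, energyDensity]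
  have e : (partialT ψ (t, r) ^ 2 + partialR ψ (t, r) ^ 2 + Real.sin (ψ t r) ^ 2 / r ^ 2) * r
      = 2 * (r / 2 * (partialT ψ (t, r) ^ 2 + partialR ψ (t, r) ^ 2)
        + Real.sin (ψ t r) ^ 2 / (2 * r)) := by field_simp
  have h0 : 0 ≤ r / 2 * (partialT ψ (t, r) ^ 2 + partialR ψ (t, r) ^ 2)
        + Real.sin (ψ t r) ^ 2 / (2 * r) := by positivity
  rw [e]
  linarith

/-- No energy escapes through the origin: smoothness of the angle up to `r = 0` bounds the flux by
a multiple of `r`. -/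
theorem IsSmoothGlobal.exists_flux_le (hψ : IsSmoothGlobal ψ) {a b : ℝ} (ha : 0 < a) :
    ∃ C : ℝ, ∀ t r, t ∈ Icc a b → 0 < r → r ≤ 1 → |energyFlux ψ (t, r)| ≤ C * r := by
  have hsub : Icc a b ×ˢ Icc (0 : ℝ) 1 ⊆ Ici (0 : ℝ) ×ˢ Ici (0 : ℝ) :=
    prod_mono (fun t ht => ha.le.trans ht.1) (fun r hr => hr.1)
  have hcont := (hψ.smooth_angle.continuousOn_fderivWithin
    ((uniqueDiffOn_Ici 0).prod (uniqueDiffOn_Ici 0)) (by simp)).mono hsub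
  obtain ⟨C, hC⟩ := (isCompact_Icc.prod isCompact_Icc).exists_bound_of_continuousOn hcont
  refine ⟨C ^ 2, fun t r ht hr hr1 => ?_⟩
  have ht0 : 0 < t := ha.trans_le ht.1
  have h := hC (t, r) ⟨ht, hr.le, hr1⟩
  rw [fderivWithin_of_mem_nhds (prod_mem_nhds (Ici_mem_nhds ht0) (Ici_mem_nhds hr))] at h
  have hC0 : 0 ≤ C := (norm_nonneg _).trans h
  have hT : |partialT ψ (t, r)| ≤ C :=
    ((fderiv ℝ (fun p : ℝ × ℝ => ψ p.1 p.2) (t, r)).le_opNorm (1, 0)).trans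
      (by simpa [Prod.norm_def] using h)
  have hR : |partialR ψ (t, r)| ≤ C :=
    ((fderiv ℝ (fun p : ℝ × ℝ => ψ p.1 p.2) (t, r)).le_opNorm (0, 1)).trans
      (by simpa [Prod.norm_def] using h)
  rw [energyFlux, abs_mul, abs_mul, abs_of_pos (show (0 : ℝ) < (t, r).2 from hr)]
  have := mul_le_mul hT hR (abs_nonneg _) hC0
  simp only
  nlinarith

/-- The potential is bounded, and the energy outside a ball is controlled by the energy at time
`1` outside a smaller ball. -/
theorem IsEnergyPotential.bounds (hψ : IsSmoothGlobal ψ) (hΦ : IsEnergyPotential ψ Φ) :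
    ∃ m M : ℝ, (∀ p ∈ quadrant, m ≤ Φ p) ∧ (∀ p ∈ quadrant, Φ p ≤ M) ∧
      ∀ ε > 0, ∃ R > 0, ∀ t r, 0 < t → R + |t - 1| ≤ r → M - ε ≤ Φ (t, r) := by
  obtain ⟨E, hE⟩ := IsEnergyPotential.sub_le_energy hψ hΦ zero_lt_one
  obtain ⟨M, hM⟩ := Real.exists_isLUB (s := (fun r => Φ (1, r)) '' Ici 1)
    (nonempty_Ici.image _) ⟨Φ (1, 1) + E, by
      rintro _ ⟨r, hr, rfl⟩
      have := hE 1 r one_pos hr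
      simp only
      linarith⟩
  have hM' : ∀ p ∈ quadrant, Φ p ≤ M := by
    intro p hp
    have hp2 : 0 < p.2 := hp.2
    have h0 := abs_nonneg (1 - p.1)
    refine le_trans (hΦ.le_of_cone (q := (1, p.2 + |1 - p.1| + 1)) hp
      (mk_mem_quadrant one_pos (by linarith)) ?_) (hM.1 ⟨_, ?_, rfl⟩)
    · simp only; linarith
    · simp only [mem_Ici]; linarith
  have hm1 : ∀ r, 0 < r → r ≤ 1 → Φ (1, 1) - E ≤ Φ (1, r) := fun r hr hr1 => by
    linarith [hE r 1 hr hr1]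
  refine ⟨Φ (1, 1) - E, M, ?_, hM', ?_⟩
  · -- On the line `r = δ` the potential differs from its value at time `1` by `O(δ)`.
    rintro ⟨t, r⟩ ⟨ht, hr⟩
    have ht : 0 < t := ht
    have hr : 0 < r := hr
    have hmin : 0 < min 1 t := lt_min one_pos ht
    obtain ⟨C, hC⟩ := hψ.exists_flux_le (b := max 1 t) hmin
    have hlow : ∀ δ, 0 < δ → δ < min 1 r → Φ (1, 1) - E - C * δ * |t - 1| ≤ Φ (t, r) := by
      intro δ hδ hδ1
      have hδr := hδ1.trans_le (min_le_right _ _)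
      have hδ1 := hδ1.trans_le (min_le_left _ _)
      have h := (convex_Icc (min 1 t) (max 1 t)).norm_image_sub_le_of_norm_hasDerivWithin_le
        (f := fun s => Φ (s, δ)) (f' := fun s => energyFlux ψ (s, δ)) (C := C * δ)
        (x := 1) (y := t)
        (fun s hs => (hasDerivAt_slice_left
          (hΦ.hasFDerivAt (mk_mem_quadrant (hmin.trans_le hs.1) hδ))).hasDerivWithinAt)
        (fun s hs => hC s δ hs hδ hδ1.le)
        ⟨min_le_left _ _, le_max_left _ _⟩ ⟨min_le_right _ _, le_max_right _ _⟩
      rw [Real.norm_eq_abs, Real.norm_eq_abs] at h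
      have := neg_abs_le (Φ (t, δ) - Φ (1, δ))
      linarith [hm1 δ hδ hδ1.le, hΦ.mono_radius ht hδ hδr.le]
    have hlim : Tendsto (fun δ : ℝ => Φ (1, 1) - E - C * δ * |t - 1|) (𝓝[>] 0)
        (𝓝 (Φ (1, 1) - E)) := by
      have : ContinuousAt (fun δ : ℝ => Φ (1, 1) - E - C * δ * |t - 1|) 0 := by fun_prop
      have h := this.tendsto
      simp only [mul_zero, zero_mul, sub_zero] at h
      exact h.mono_left nhdsWithin_le_nhds
    refine le_of_tendsto hlim ?_
    filter_upwards [Ioo_mem_nhdsGT (lt_min one_pos hr)] with δ hδ using hlow δ hδ.1 hδ.2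
  · intro ε hε
    obtain ⟨_, ⟨R, hR, rfl⟩, h, -⟩ := hM.exists_between (show M - ε < M by linarith)
    have hR0 : 0 < R := one_pos.trans_le hR
    refine ⟨R, hR0, fun t r ht hr => h.le.trans ?_⟩
    refine hΦ.le_of_cone (mk_mem_quadrant one_pos hR0)
      (mk_mem_quadrant ht (by linarith [abs_nonneg (t - 1)])) ?_
    simp only; linarith

/-! ### Energy inside the light cone -/

/-- The source in the momentum balance is controlled by the geometric mean of the two null energy
fluxes: it contains `(ψₜ + ψᵣ)²` and `(ψₜ - ψᵣ)²` only through their product and through terms with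
a factor `sin ψ / r`. -/
theorem sq_momentum_source_le {p : ℝ × ℝ} (hp : p ∈ quadrant) :
    (((partialR ψ p ^ 2 - partialT ψ p ^ 2) / 2
        - 2 * (Real.sin (ψ p.1 p.2) / p.2) * Real.cos (ψ p.1 p.2) * partialR ψ p
        + (Real.sin (ψ p.1 p.2) / p.2) ^ 2 / 2) / 4) ^ 2 * (2 * p.2) ^ 2
      ≤ 4 ^ 2 * ((energyDensity ψ p + energyFlux ψ p) / 2
          * ((energyDensity ψ p - energyFlux ψ p) / 2)) := by
  have hr : p.2 ≠ 0 := ne_of_gt hp.2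
  have hP : energyDensity ψ p = p.2 / 2 * (partialT ψ p ^ 2 + partialR ψ p ^ 2
      + (Real.sin (ψ p.1 p.2) / p.2) ^ 2) := by
    rw [energyDensity]; field_simp
  rw [hP, energyFlux]
  set σ := Real.sin (ψ p.1 p.2) / p.2
  set c := Real.cos (ψ p.1 p.2)
  have hc : c ^ 2 ≤ 1 := Real.cos_sq_le_one _
  obtain ⟨x, hx⟩ : ∃ x, x = partialT ψ p + partialR ψ p := ⟨_, rfl⟩
  obtain ⟨y, hy⟩ : ∃ y, y = partialT ψ p - partialR ψ p := ⟨_, rfl⟩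
  have hT : partialT ψ p = (x + y) / 2 := by rw [hx, hy]; ring
  have hR : partialR ψ p = (x - y) / 2 := by rw [hx, hy]; ring
  rw [hT, hR]
  have h1 : (-(x * y) / 2 - c * σ * x + c * σ * y + σ ^ 2 / 2) ^ 2
      ≤ 4 * ((x * y) ^ 2 / 4 + c ^ 2 * (σ * x) ^ 2 + c ^ 2 * (σ * y) ^ 2 + (σ ^ 2) ^ 2 / 4) := by
    nlinarith [sq_nonneg (-(x * y) / 2 + c * σ * x), sq_nonneg (-(x * y) / 2 - c * σ * y),
      sq_nonneg (-(x * y) / 2 - σ ^ 2 / 2), sq_nonneg (c * σ * x + c * σ * y),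
      sq_nonneg (c * σ * x + σ ^ 2 / 2), sq_nonneg (c * σ * y - σ ^ 2 / 2)]
  have h2 : (x * y) ^ 2 / 4 + c ^ 2 * (σ * x) ^ 2 + c ^ 2 * (σ * y) ^ 2 + (σ ^ 2) ^ 2 / 4
      ≤ (x ^ 2 + σ ^ 2) * (y ^ 2 + σ ^ 2) := by
    nlinarith [mul_le_mul_of_nonneg_right hc (sq_nonneg (σ * x)),
      mul_le_mul_of_nonneg_right hc (sq_nonneg (σ * y)), sq_nonneg (x * y), sq_nonneg (σ ^ 2)]
  have h3 := mul_le_mul_of_nonneg_left (h1.trans (mul_le_mul_of_nonneg_left h2 zero_le_four))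
    (sq_nonneg (p.2 / 2))
  calc _ = _ := by ring
    _ ≤ _ := h3
    _ = _ := by ring

/-- Inside the forward light cone the energy converges: there are `F` and `L` with
`Φ(t, t - ξ) ≤ F ξ → L`, and `Φ(t, λ t) → L` for every `λ ∈ (0, 1)`. -/
theorem IsEnergyPotential.exists_limit (hψ : IsSmoothGlobal ψ) (hΦ : IsEnergyPotential ψ Φ) :
    ∃ (F : ℝ → ℝ) (L : ℝ), (∀ t A, 0 < A → A < t → Φ (t, t - A) ≤ F A) ∧
      Tendsto F atTop (𝓝 L) ∧
      ∀ lam, 0 < lam → lam < 1 → Tendsto (fun t => Φ (t, lam * t)) atTop (𝓝 L) := by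
  obtain ⟨m, M, hm, hM, -⟩ := IsEnergyPotential.bounds hψ hΦ
  have hmem : ∀ x y : ℝ, 0 < x → x < y → (2⁻¹ * (x + y), 2⁻¹ * (y - x)) ∈ quadrant :=
    fun x y hx hxy => mk_mem_quadrant (by linarith) (by linarith)
  -- Null coordinates `x = t - r`, `y = t + r`.
  have hder : ∀ x y : ℝ, ∃ α δ β : ℝ, 0 < x → x < y →
      HasFDerivAt (energyFlux ψ) (α • ContinuousLinearMap.fst ℝ ℝ ℝ
        + δ • ContinuousLinearMap.snd ℝ ℝ ℝ) (2⁻¹ * (x + y), 2⁻¹ * (y - x)) ∧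
      HasFDerivAt (energyDensity ψ) (δ • ContinuousLinearMap.fst ℝ ℝ ℝ
        + β • ContinuousLinearMap.snd ℝ ℝ ℝ) (2⁻¹ * (x + y), 2⁻¹ * (y - x)) ∧
      ((α - β) / 4) ^ 2 * (y - x) ^ 2 ≤ 4 ^ 2 *
        ((energyDensity ψ (2⁻¹ * (x + y), 2⁻¹ * (y - x))
            + energyFlux ψ (2⁻¹ * (x + y), 2⁻¹ * (y - x))) / 2
          * ((energyDensity ψ (2⁻¹ * (x + y), 2⁻¹ * (y - x))
            - energyFlux ψ (2⁻¹ * (x + y), 2⁻¹ * (y - x))) / 2)) := by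
    intro x y
    by_cases h : 0 < x ∧ x < y
    · have hp := hmem x y h.1 h.2
      obtain ⟨α, δ, β, h1, h2, h3⟩ := hψ.hasFDerivAt_energy hp
      refine ⟨α, δ, β, fun _ _ => ⟨h1, h2, ?_⟩⟩
      have hyx : y - x = 2 * (2⁻¹ * (x + y), 2⁻¹ * (y - x)).2 := by simp
      refine le_trans (le_of_eq ?_) (sq_momentum_source_le (ψ := ψ) hp)
      rw [h3, ← hyx]
    · exact ⟨0, 0, 0, fun hx hy => absurd ⟨hx, hy⟩ h⟩
  choose α δ β hder using hder
  have hX : ∀ x y : ℝ, HasDerivAt (fun x => (2⁻¹ * (x + y), 2⁻¹ * (y - x))) (2⁻¹, -2⁻¹) x := by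
    intro x y
    exact (((hasDerivAt_id x).add_const y).const_mul 2⁻¹).prodMk
      (((hasDerivAt_id x).const_sub y).const_mul 2⁻¹) |>.congr_deriv (by simp)
  have hY : ∀ x y : ℝ, HasDerivAt (fun y => (2⁻¹ * (x + y), 2⁻¹ * (y - x))) (2⁻¹, 2⁻¹) y := by
    intro x y
    exact (((hasDerivAt_id y).const_add x).const_mul 2⁻¹).prodMk
      (((hasDerivAt_id y).sub_const x).const_mul 2⁻¹) |>.congr_deriv (by simp)
  obtain ⟨F, L, hF, hFL, hlim⟩ := exists_null_limit
    (W := fun x y => Φ (2⁻¹ * (x + y), 2⁻¹ * (y - x)))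
    (a := fun x y => (energyDensity ψ (2⁻¹ * (x + y), 2⁻¹ * (y - x))
            + energyFlux ψ (2⁻¹ * (x + y), 2⁻¹ * (y - x))) / 2)
    (b := fun x y => (energyDensity ψ (2⁻¹ * (x + y), 2⁻¹ * (y - x))
            - energyFlux ψ (2⁻¹ * (x + y), 2⁻¹ * (y - x))) / 2)
    (a' := fun x y => (α x y - β x y) / 4) (C := 4) (m := m) (M := M)
    (fun x y hx hy => by
      have := abs_le.1 (abs_energyFlux_le (ψ := ψ) (hmem x y hx hy))
      linarith)
    (fun x y hx hy => by
      have := abs_le.1 (abs_energyFlux_le (ψ := ψ) (hmem x y hx hy))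
      linarith)
    (fun x y hx hy => ((hΦ.hasFDerivAt (hmem x y hx hy)).comp_hasDerivAt x (hX x y)).congr_deriv
      (by simp; ring))
    (fun x y hx hy => ((hΦ.hasFDerivAt (hmem x y hx hy)).comp_hasDerivAt y (hY x y)).congr_deriv
      (by simp; ring))
    (fun x y hx hy => ((((hder x y hx hy).2.1.comp_hasDerivAt x (hX x y)).add
      ((hder x y hx hy).1.comp_hasDerivAt x (hX x y))).div_const 2).congr_deriv
      (by simp; ring))
    (fun x y hx hy => (hder x y hx hy).2.2)
    (fun x y hx hy => hm _ (hmem x y hx hy)) (fun x y hx hy => hM _ (hmem x y hx hy))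
  refine ⟨F, L, fun t A hA hAt => ?_, hFL, fun lam h0 h1 => ?_⟩
  · have h := hF A (2 * t - A) hA (by linarith)
    have e1 : 2⁻¹ * (A + (2 * t - A)) = t := by ring
    have e2 : 2⁻¹ * (2 * t - A - A) = t - A := by ring
    simpa only [e1, e2] using h
  · -- The point `(t, λ t)` has null coordinates `u = (1 - λ) t` and `(1 + λ) t = κ u`.
    have h1' : 0 < 1 - lam := by linarith
    have h := (hlim ((1 + lam) / (1 - lam)) (by rw [lt_div_iff₀ h1']; linarith)).comp
      (tendsto_id.const_mul_atTop h1')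
    refine h.congr fun t => ?_
    simp only [Function.comp_apply, id_eq]
    congr 2
    · field_simp; ring
    · field_simp; ring

/-! ### Behaviour of the angle -/

/-- A function whose derivative is dominated by that of `g` varies no more than `g`. -/
theorem abs_sub_le_of_abs_deriv_le {f g f' g' : ℝ → ℝ} {a b : ℝ} (hab : a ≤ b)
    (hf : ∀ x ∈ Icc a b, HasDerivAt f (f' x) x) (hg : ∀ x ∈ Icc a b, HasDerivAt g (g' x) x)
    (h : ∀ x ∈ Icc a b, |f' x| ≤ g' x) : |f b - f a| ≤ g b - g a := by
  have h₁ : MonotoneOn (g + f) (Icc a b) :=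
    monotoneOn_of_hasDerivWithinAt_nonneg (convex_Icc _ _)
      (fun x hx => ((hg x hx).add (hf x hx)).continuousAt.continuousWithinAt)
      (fun x hx => ((hg x (interior_subset hx)).add
        (hf x (interior_subset hx))).hasDerivWithinAt)
      (fun x hx => by linarith [abs_le.1 (h x (interior_subset hx))])
  have h₂ : MonotoneOn (g - f) (Icc a b) :=
    monotoneOn_of_hasDerivWithinAt_nonneg (convex_Icc _ _)
      (fun x hx => ((hg x hx).sub (hf x hx)).continuousAt.continuousWithinAt)
      (fun x hx => ((hg x (interior_subset hx)).sub
        (hf x (interior_subset hx))).hasDerivWithinAt)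
      (fun x hx => by linarith [abs_le.1 (h x (interior_subset hx))])
  have h1 := h₁ (left_mem_Icc.2 hab) (right_mem_Icc.2 hab) hab
  have h2 := h₂ (left_mem_Icc.2 hab) (right_mem_Icc.2 hab) hab
  simp only [Pi.add_apply, Pi.sub_apply] at h1 h2
  rw [abs_le]
  constructor <;> linarith

/-- The oscillation of `cos ψ` on an annulus is at most the energy of the annulus. -/
theorem IsEnergyPotential.abs_cos_sub_le (hψ : IsSmoothGlobal ψ) (hΦ : IsEnergyPotential ψ Φ)
    {t a b : ℝ} (ht : 0 < t) (ha : 0 < a) (hab : a ≤ b) :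
    |Real.cos (ψ t b) - Real.cos (ψ t a)| ≤ Φ (t, b) - Φ (t, a) := by
  have hf : ∀ r ∈ Icc a b, HasDerivAt (fun s => Real.cos (ψ t s))
      (-Real.sin (ψ t r) * partialR ψ (t, r)) r :=
    fun r hr => (hψ.hasDerivAt_radius ht (ha.trans_le hr.1)).cos
  have hg : ∀ r ∈ Icc a b, HasDerivAt (fun s => Φ (t, s)) (energyDensity ψ (t, r)) r :=
    fun r hr => hΦ.hasDerivAt_radius ht (ha.trans_le hr.1)
  have hle : ∀ r ∈ Icc a b,
      |-Real.sin (ψ t r) * partialR ψ (t, r)| ≤ energyDensity ψ (t, r) := by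
    intro r hr
    have h := abs_sin_mul_partialR_le (ψ := ψ) (mk_mem_quadrant ht (ha.trans_le hr.1))
    rwa [neg_mul, abs_neg]
  exact abs_sub_le_of_abs_deriv_le hab hf hg hle

/-- The angle varies little across a strip of bounded width at large radius `a`: choose `σ` small and
then `a` large. -/
theorem IsEnergyPotential.abs_angle_sub_le (hψ : IsSmoothGlobal ψ) (hΦ : IsEnergyPotential ψ Φ)
    {t a b σ : ℝ} (ht : 0 < t) (ha : 0 < a) (hab : a ≤ b) (hσ : 0 < σ) :
    |ψ t b - ψ t a| ≤ σ / 2 * (b - a) + (Φ (t, b) - Φ (t, a)) / (σ * a) := by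
  have h := abs_sub_le_of_abs_deriv_le (f := ψ t) (g := fun r => σ / 2 * r + Φ (t, r) / (σ * a))
    (f' := fun r => partialR ψ (t, r))
    (g' := fun r => σ / 2 * 1 + energyDensity ψ (t, r) / (σ * a)) hab
    (fun r hr => hψ.hasDerivAt_radius ht (ha.trans_le hr.1))
    (fun r hr => ((hasDerivAt_id r).const_mul _).add
      ((hΦ.hasDerivAt_radius ht (ha.trans_le hr.1)).div_const _)) (fun r hr => ?_)
  · refine h.trans (le_of_eq ?_)
    ring
  · have hq := mk_mem_quadrant ht (ha.trans_le hr.1)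
    have h0 := energyDensity_nonneg (ψ := ψ) hq
    refine (abs_partialR_le hq hσ).trans ?_
    rw [mul_one]
    have : energyDensity ψ (t, r) / (σ * r) ≤ energyDensity ψ (t, r) / (σ * a) := by
      gcongr
      exact hr.1
    simpa using this

theorem IsSmoothGlobal.continuousOn_time (hψ : IsSmoothGlobal ψ) {r : ℝ} (hr : 0 ≤ r) :
    ContinuousOn (fun t => ψ t r) (Ici 0) :=
  hψ.smooth_angle.continuousOn.comp (f := fun t => (t, r)) (by fun_prop) fun _ ht => ⟨ht, hr⟩

theorem IsSmoothGlobal.continuousOn_radius (hψ : IsSmoothGlobal ψ) {t : ℝ} (ht : 0 ≤ t) :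
    ContinuousOn (ψ t) (Ici 0) :=
  hψ.smooth_angle.continuousOn.comp (f := fun r => (t, r)) (by fun_prop) fun _ hr => ⟨ht, hr⟩

/-- If `cos g` stays close to `cos (n π)` on a half-line at whose end `g` tends to `n π`, then `g`
stays close to `n π`, since it cannot cross `n π ± δ`. -/
theorem abs_sub_int_mul_pi_lt {g : ℝ → ℝ} {n : ℤ} {δ r₀ : ℝ} (hδ : 0 < δ)
    (hg : ContinuousOn g (Ici r₀)) (hlim : Tendsto g atTop (𝓝 (n * Real.pi)))
    (hcos : ∀ r, r₀ ≤ r → |Real.cos (g r) - Real.cos (n * Real.pi)| < 1 - Real.cos δ) {r : ℝ}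
    (hr : r₀ ≤ r) : |g r - n * Real.pi| < δ := by
  by_contra! hcon
  have hev : ∀ᶠ s in atTop, |g s - n * Real.pi| < δ := by
    have := (Metric.tendsto_nhds.1 hlim) δ hδ
    simpa only [Real.dist_eq] using this
  obtain ⟨s, hs, hrs⟩ := (hev.and (eventually_ge_atTop r)).exists
  have hcont : ContinuousOn (fun s => |g s - n * Real.pi|) (Icc r s) :=
    ((hg.mono fun x hx => hr.trans hx.1).sub continuousOn_const).abs
  obtain ⟨x, hx, hxδ⟩ := intermediate_value_Icc' hrs hcont ⟨hs.le, hcon⟩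
  have h := hcos x (hr.trans hx.1)
  have hsin : Real.sin (n * Real.pi) = 0 := Real.sin_int_mul_pi n
  have hcos1 : |Real.cos (n * Real.pi)| = 1 := Real.abs_cos_int_mul_pi n
  have e : Real.cos (g x) - Real.cos (n * Real.pi)
      = Real.cos (n * Real.pi) * (Real.cos δ - 1) := by
    have h1 : Real.cos (g x) = Real.cos (n * Real.pi + (g x - n * Real.pi)) := by ring_nf
    rw [h1, Real.cos_add, hsin, ← Real.cos_abs (g x - n * Real.pi)]
    simp only at hxδ
    rw [hxδ]
    ring
  rw [e, abs_mul, hcos1, one_mul, abs_sub_comm, abs_of_nonneg (by linarith [Real.cos_le_one δ])]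
    at h
  exact lt_irrefl _ h

theorem one_sub_cos_pos {δ : ℝ} (h0 : 0 < δ) (hπ : δ < Real.pi) : 0 < 1 - Real.cos δ := by
  have := Real.cos_lt_cos_of_nonneg_of_le_pi le_rfl hπ.le h0
  rw [Real.cos_zero] at this
  linarith

theorem IsEnergyPotential.abs_cos_sub_limit_le (hψ : IsSmoothGlobal ψ)
    (hΦ : IsEnergyPotential ψ Φ) {M : ℝ} (hM : ∀ p ∈ quadrant, Φ p ≤ M) {t r θ : ℝ} (ht : 0 < t)
    (hr : 0 < r) (hlim : Tendsto (ψ t) atTop (𝓝 θ)) :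
    |Real.cos (ψ t r) - Real.cos θ| ≤ M - Φ (t, r) := by
  have h : Tendsto (fun s => |Real.cos (ψ t s) - Real.cos (ψ t r)|) atTop
      (𝓝 |Real.cos θ - Real.cos (ψ t r)|) :=
    (((Real.continuous_cos.tendsto θ).comp hlim).sub_const _).abs
  rw [abs_sub_comm]
  refine le_of_tendsto h ?_
  filter_upwards [eventually_ge_atTop r] with s hs
  linarith [hΦ.abs_cos_sub_le hψ ht hr hs, hM _ (mk_mem_quadrant ht (hr.trans_le hs))]

/-- Outside a light cone the angle is uniformly close to its limit at spatial infinity. -/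
theorem IsSmoothGlobal.exterior_close (hψ : IsSmoothGlobal ψ) {δ : ℝ} (hδ : 0 < δ)
    (hδπ : δ < Real.pi) : ∃ R > 0, ∀ (t r : ℝ) (n : ℤ), 0 < t → R + |t - 1| ≤ r →
      Tendsto (ψ t) atTop (𝓝 (n * Real.pi)) → |ψ t r - n * Real.pi| < δ := by
  obtain ⟨Φ, hΦ⟩ := hψ.exists_energyPotential
  obtain ⟨m, M, -, hM, hext⟩ := hΦ.bounds hψ
  have hpos := one_sub_cos_pos hδ hδπ
  obtain ⟨R, hR, hRM⟩ := hext ((1 - Real.cos δ) / 2) (by linarith)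
  refine ⟨R, hR, fun t r n ht hr hlim => ?_⟩
  have hr0 : 0 < R + |t - 1| := by positivity
  refine abs_sub_int_mul_pi_lt (r₀ := R + |t - 1|) hδ
    ((hψ.continuousOn_radius ht.le).mono (Ici_subset_Ici.2 hr0.le)) hlim (fun s hs => ?_) hr
  linarith [hΦ.abs_cos_sub_limit_le hψ hM ht (hr0.trans_le hs) hlim, hRM t s ht hs]

/-- A continuous function that stays within distance `1 < π / 2` of `π ℤ` stays near one and the
same multiple of `π`. -/
theorem int_eq_of_continuousOn {f : ℝ → ℝ} {n : ℝ → ℤ} {s t : ℝ} (hst : s ≤ t)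
    (hf : ContinuousOn f (Icc s t)) (h : ∀ x ∈ Icc s t, |f x - n x * Real.pi| < 1) :
    n s = n t := by
  have hπ := Real.pi_gt_three
  have havoid : ∀ x ∈ Icc s t, ∀ j : ℤ, f x ≠ j * Real.pi + Real.pi / 2 := by
    intro x hx j hj
    have h1 := abs_lt.1 (h x hx)
    rw [hj] at h1
    rcases le_or_gt (n x) j with hn | hn
    · have : (n x : ℝ) ≤ j := by exact_mod_cast hn
      nlinarith
    · have : (j : ℝ) + 1 ≤ n x := by exact_mod_cast hn
      nlinarith
  have hs := abs_lt.1 (h s (left_mem_Icc.2 hst))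
  have ht := abs_lt.1 (h t (right_mem_Icc.2 hst))
  rcases lt_trichotomy (n s) (n t) with hn | hn | hn
  · have : (n s : ℝ) + 1 ≤ n t := by exact_mod_cast hn
    obtain ⟨x, hx, hxe⟩ := intermediate_value_Icc hst hf
      (show (n s : ℝ) * Real.pi + Real.pi / 2 ∈ Icc (f s) (f t) by
        constructor <;> nlinarith)
    exact absurd hxe (havoid x hx _)
  · exact hn
  · have : (n t : ℝ) + 1 ≤ n s := by exact_mod_cast hn
    obtain ⟨x, hx, hxe⟩ := intermediate_value_Icc' hst hf
      (show (n t : ℝ) * Real.pi + Real.pi / 2 ∈ Icc (f t) (f s) by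
        constructor <;> nlinarith)
    exact absurd hxe (havoid x hx _)

/-- The limit of the angle at spatial infinity does not depend on time. -/
theorem IsSmoothGlobal.exists_limit (hψ : IsSmoothGlobal ψ) :
    ∃ k : ℤ, ∀ t : ℝ, 0 ≤ t → Tendsto (ψ t) atTop (𝓝 (k * Real.pi)) := by
  have hn : ∀ t : ℝ, ∃ n : ℤ, 0 ≤ t → Tendsto (ψ t) atTop (𝓝 (n * Real.pi)) := by
    intro t
    by_cases ht : 0 ≤ t
    · obtain ⟨n, -, -, h⟩ := hψ.energy_space t ht
      exact ⟨n, fun _ => h⟩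
    · exact ⟨0, fun h => absurd h ht⟩
  choose n hn using hn
  have hπ := Real.pi_gt_three
  obtain ⟨R, hR, hclose⟩ := hψ.exterior_close one_pos (by linarith)
  have hle : ∀ s t, 0 < s → s ≤ t → n s = n t := by
    intro s t hs hst
    have hr : 0 < R + |s - 1| + |t - 1| := by positivity
    refine int_eq_of_continuousOn (f := fun x => ψ x (R + |s - 1| + |t - 1|)) hst
      ((hψ.continuousOn_time hr.le).mono fun x hx => hs.le.trans hx.1) fun x hx => ?_
    have hx0 : 0 < x := hs.trans_le hx.1
    refine hclose x _ (n x) hx0 ?_ (hn x hx0.le)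
    have : |x - 1| ≤ |s - 1| + |t - 1| := by
      rw [abs_le]
      constructor
      · linarith [neg_abs_le (s - 1), abs_nonneg (t - 1), hx.1]
      · linarith [le_abs_self (t - 1), abs_nonneg (s - 1), hx.2]
    linarith
  have hpos : ∀ t, 0 < t → n t = n 1 := fun t ht => by
    rcases le_total t 1 with h | h
    · exact hle t 1 ht h
    · exact (hle 1 t one_pos h).symm
  -- The exterior estimate is uniform for `t` near `0`, so it passes to the limit `t → 0`.
  have hzero : n 0 = n 1 := by
    have hb : ∀ r, R + 1 ≤ r → |ψ 0 r - n 1 * Real.pi| ≤ 1 := by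
      intro r hr
      have hc : Tendsto (fun t => |ψ t r - n 1 * Real.pi|) (𝓝[>] 0)
          (𝓝 |ψ 0 r - n 1 * Real.pi|) :=
        ((((hψ.continuousOn_time (r := r) (by linarith)) 0 self_mem_Ici).mono
          Ioi_subset_Ici_self).tendsto.sub_const _).abs
      refine le_of_tendsto hc ?_
      filter_upwards [Ioo_mem_nhdsGT (zero_lt_one' ℝ)] with t ht
      have h1 := hn t ht.1.le
      rw [hpos t ht.1] at h1
      refine (hclose t r (n 1) ht.1 ?_ h1).le
      have : |t - 1| ≤ 1 := by
        rw [abs_le]; constructor <;> linarith [ht.1, ht.2]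
      linarith
    have hlim : |(n 0 : ℝ) * Real.pi - n 1 * Real.pi| ≤ 1 := by
      refine le_of_tendsto ((hn 0 le_rfl).sub_const _).abs ?_
      filter_upwards [eventually_ge_atTop (R + 1)] with r hr using hb r hr
    rw [abs_le] at hlim
    rcases lt_trichotomy (n 0) (n 1) with h | h | h
    · have : (n 0 : ℝ) + 1 ≤ n 1 := by exact_mod_cast h
      nlinarith
    · exact h
    · have : (n 1 : ℝ) + 1 ≤ n 0 := by exact_mod_cast h
      nlinarith
  refine ⟨n 1, fun t ht => ?_⟩
  have h := hn t ht
  rcases ht.eq_or_lt with h0 | h0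
  · rwa [← h0, hzero, h0] at h
  · rwa [hpos t h0] at h

/-- Uniform convergence of the angle in `r ≥ λ t` for `λ < 1`. The region is split at the light
cone: the energy is small in `λ t ≤ r ≤ t - A` and in `r ≥ t + R`, and the strip in between has
bounded width and large radius. -/
theorem IsSmoothGlobal.eventually_close (hψ : IsSmoothGlobal ψ) {k : ℤ}
    (hk : ∀ t : ℝ, 0 ≤ t → Tendsto (ψ t) atTop (𝓝 (k * Real.pi))) {lam δ : ℝ} (hlam : 0 < lam)
    (hlam1 : lam < 1) (hδ : 0 < δ) (hδπ : δ < Real.pi) :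
    ∀ᶠ t in atTop, ∀ r, lam * t ≤ r → |ψ t r - k * Real.pi| < δ := by
  obtain ⟨Φ, hΦ⟩ := hψ.exists_energyPotential
  obtain ⟨m, M, hm, hM, hext⟩ := hΦ.bounds hψ
  obtain ⟨F, L, hF, hFL, hlim⟩ := hΦ.exists_limit hψ
  -- The three regions contribute `2 ε`, `ε` and `ε`, which is less than `1 - cos δ`.
  obtain ⟨ε, hε⟩ : ∃ ε, ε = (1 - Real.cos δ) / 5 := ⟨_, rfl⟩
  have hε0 : 0 < ε := by rw [hε]; linarith [one_sub_cos_pos hδ hδπ]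
  obtain ⟨R, hR, hRM⟩ := hext ε hε0
  obtain ⟨A, hFA, hA⟩ := ((hFL.eventually (gt_mem_nhds (show L < L + ε by linarith))).and
    (eventually_gt_atTop 0)).exists
  obtain ⟨σ, hσ⟩ : ∃ σ, σ = ε / (A + R) := ⟨_, rfl⟩
  have hσ0 : 0 < σ := by rw [hσ]; positivity
  have hMm : 0 ≤ M - m := by
    have h1 := mk_mem_quadrant one_pos one_pos
    linarith [hm _ h1, hM _ h1]
  filter_upwards [(hlim lam hlam hlam1).eventually (lt_mem_nhds (show L - ε < L by linarith)),
    eventually_gt_atTop (A + 1 + 2 * (M - m) / (σ * ε))] with t htL htA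
  have hq0 : 0 ≤ 2 * (M - m) / (σ * ε) := by positivity
  have ht : 0 < t := by linarith
  have htA0 : 0 < t - A := by linarith
  have hlt : 0 < lam * t := by positivity
  have h1 : ∀ r, lam * t ≤ r →
      |Real.cos (ψ t (max r (t - A))) - Real.cos (ψ t r)| ≤ 2 * ε := by
    intro r hr
    rcases le_total (t - A) r with h | h
    · rw [max_eq_left h, sub_self, abs_zero]; linarith
    · rw [max_eq_right h]
      linarith [hΦ.abs_cos_sub_le hψ ht (hlt.trans_le hr) h, hF t A hA (by linarith),
        hΦ.mono_radius ht hlt hr]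
  have h2 : ∀ r, t - A ≤ r →
      |Real.cos (ψ t (max r (t + R))) - Real.cos (ψ t r)| ≤ ε := by
    intro r hr
    rcases le_total (t + R) r with h | h
    · rw [max_eq_left h, sub_self, abs_zero]; linarith
    · rw [max_eq_right h]
      have hr0 : 0 < r := htA0.trans_le hr
      refine (Real.abs_cos_sub_cos_le _ _).trans ((hΦ.abs_angle_sub_le hψ ht hr0 h hσ0).trans ?_)
      have e1 : σ / 2 * (t + R - r) ≤ ε / 2 := by
        have : σ / 2 * (t + R - r) ≤ σ / 2 * (A + R) := by gcongr; linarith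
        refine this.trans (le_of_eq ?_)
        rw [hσ]; field_simp
      have e2 : (Φ (t, t + R) - Φ (t, r)) / (σ * r) ≤ ε / 2 := by
        rw [div_le_iff₀ (by positivity)]
        have h3 : Φ (t, t + R) - Φ (t, r) ≤ M - m := by
          linarith [hM _ (mk_mem_quadrant ht (by linarith : 0 < t + R)),
            hm _ (mk_mem_quadrant ht hr0)]
        have h4 : 2 * (M - m) / (σ * ε) ≤ r := by linarith
        rw [div_le_iff₀ (by positivity)] at h4
        linarith
      linarith
  have h3 : ∀ r, t + R ≤ r → |Real.cos (ψ t r) - Real.cos (k * Real.pi)| ≤ ε := by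
    intro r hr
    have hab : |t - 1| ≤ t := by
      rw [abs_le]; constructor <;> linarith
    linarith [hΦ.abs_cos_sub_limit_le hψ hM ht (by linarith : 0 < r) (hk t ht.le),
      hRM t r ht (by linarith)]
  intro r hr
  refine abs_sub_int_mul_pi_lt (r₀ := lam * t) hδ
    ((hψ.continuousOn_radius ht.le).mono (Ici_subset_Ici.2 hlt.le)) (hk t ht.le)
    (fun s hs => ?_) hr
  have a1 := abs_le.1 (h1 s hs)
  have a2 := abs_le.1 (h2 (max s (t - A)) (le_max_right _ _))
  have a3 := abs_le.1 (h3 (max (max s (t - A)) (t + R)) (le_max_right _ _))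
  rw [abs_lt]
  constructor <;> linarith

/-! ### Decay of the local norm -/

/-- Where the angle is within `π / 2` of `k π`, the local norm is controlled by the local energy. -/
theorem IsEnergyPotential.normHL2Sq_le (hψ : IsSmoothGlobal ψ) (hΦ : IsEnergyPotential ψ Φ)
    {k : ℤ} {t a b : ℝ} (ht : 0 < t) (ha : 0 < a) (hab : a ≤ b)
    (hclose : ∀ r ∈ Icc a b, |ψ t r - k * Real.pi| ≤ Real.pi / 2) :
    normHL2Sq (Icc a b) (fun r => ψ t r - k * Real.pi) (timeDeriv ψ t)
      ≤ ENNReal.ofReal (8 * (Φ (t, b) - Φ (t, a))) := by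
  rw [ENNReal.ofReal_mul (by norm_num), ← hΦ.lintegral_energyDensity hψ ht ha hab,
    ← lintegral_const_mul' _ _ ENNReal.ofReal_ne_top, normHL2Sq]
  refine setLIntegral_mono' measurableSet_Icc fun r hr => ?_
  have hr0 : 0 < r := ha.trans_le hr.1
  rw [← ENNReal.ofReal_mul (by norm_num), hψ.timeDeriv_eq ht hr0,
    ((hψ.hasDerivAt_radius ht hr0).sub_const _).deriv]
  refine ENNReal.ofReal_le_ofReal ?_
  have hsin : Real.sin (ψ t r - k * Real.pi) ^ 2 = Real.sin (ψ t r) ^ 2 := by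
    have h1 : ((-1 : ℝ) ^ k) ^ 2 = 1 := by
      rw [← zpow_natCast, ← zpow_mul, mul_comm, zpow_mul]
      simp
    rw [Real.sin_sub_int_mul_pi, mul_pow, h1, one_mul]
  have hjordan : (ψ t r - k * Real.pi) ^ 2 ≤ 4 * Real.sin (ψ t r) ^ 2 := by
    have h := Real.mul_abs_le_abs_sin (hclose r hr)
    have h2 : |ψ t r - k * Real.pi| ≤ 2 * |Real.sin (ψ t r - k * Real.pi)| := by
      have h3 : (1 : ℝ) / 2 ≤ 2 / Real.pi := by
        rw [div_le_div_iff₀ two_pos Real.pi_pos]; linarith [Real.pi_le_four]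
      nlinarith [mul_le_mul_of_nonneg_right h3 (abs_nonneg (ψ t r - k * Real.pi))]
    rw [← hsin, ← sq_abs, ← sq_abs (Real.sin _)]
    nlinarith [abs_nonneg (ψ t r - k * Real.pi)]
  have e : 8 * energyDensity ψ (t, r) = (4 * partialT ψ (t, r) ^ 2 + 4 * partialR ψ (t, r) ^ 2
      + 4 * Real.sin (ψ t r) ^ 2 / r ^ 2) * r := by
    rw [energyDensity]; field_simp; ring
  rw [e]
  gcongr
  · linarith [sq_nonneg (partialT ψ (t, r))]
  · linarith [sq_nonneg (partialR ψ (t, r))]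

end EquivariantWaveMap
end

theorem corollary2p4 (ψ : ℝ → ℝ → ℝ) (hψ : EquivariantWaveMap.IsSmoothGlobal ψ) :
    ∃ k : ℤ,
      (∀ t : ℝ, 0 ≤ t → Tendsto (ψ t) atTop (𝓝 (k * Real.pi))) ∧
      (∀ lam : ℝ, 0 < lam →
        Tendsto (fun t : ℝ => ⨆ r ∈ Ici (lam * t), ‖ψ t r - k * Real.pi‖ₑ) atTop (𝓝 0)) ∧
      (∀ lam : ℝ, 0 < lam → lam < 1 →
        Tendsto
          (fun A : ℝ =>
            limsup
              (fun t : ℝ =>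
                EquivariantWaveMap.normHL2Sq (Icc (lam * t) (t - A))
                  (fun r => ψ t r - k * Real.pi) (EquivariantWaveMap.timeDeriv ψ t))
              atTop)
          atTop (𝓝 0)) := by
  obtain ⟨k, hk⟩ := hψ.exists_limit
  refine ⟨k, hk, fun lam hlam => ?_, fun lam hlam hlam1 => ?_⟩
  · rw [ENNReal.tendsto_nhds_zero]
    intro ε hε
    obtain ⟨e, he0, heε⟩ := ENNReal.lt_iff_exists_nnreal_btwn.1 hε
    have he0 : (0 : ℝ) < e := by exact_mod_cast he0
    filter_upwards [hψ.eventually_close hk (lt_min hlam one_half_pos)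
      ((min_le_right lam (1 / 2)).trans_lt (by norm_num)) (lt_min he0 one_pos)
      ((min_le_right _ _).trans_lt (by linarith [Real.pi_gt_three])),
      eventually_ge_atTop 0] with t ht ht0
    refine iSup₂_le fun r hr => le_trans ?_ heε.le
    have h := ht r ((mul_le_mul_of_nonneg_right (min_le_left _ _) ht0).trans hr)
    rw [Real.enorm_eq_ofReal_abs]
    exact ENNReal.ofReal_le_of_le_toReal (h.le.trans (min_le_left _ _))
  · obtain ⟨Φ, hΦ⟩ := hψ.exists_energyPotential
    obtain ⟨F, L, hF, hFL, hlim⟩ := hΦ.exists_limit hψ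
    rw [ENNReal.tendsto_nhds_zero]
    intro ε hε
    obtain ⟨e, he0, heε⟩ := ENNReal.lt_iff_exists_nnreal_btwn.1 hε
    have he0 : (0 : ℝ) < e := by exact_mod_cast he0
    filter_upwards [hFL.eventually (gt_mem_nhds (show L < L + e / 16 by linarith)),
      eventually_gt_atTop 0] with A hFA hA
    refine limsup_le_of_le (by isBoundedDefault) ?_
    filter_upwards [hψ.eventually_close hk hlam hlam1 (half_pos Real.pi_pos)
        (half_lt_self Real.pi_pos),
      (hlim lam hlam hlam1).eventually (lt_mem_nhds (show L - e / 16 < L by linarith)),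
      eventually_gt_atTop A] with t hclose hL htA
    have ht : 0 < t := hA.trans htA
    refine le_trans ?_ heε.le
    rcases le_or_gt (lam * t) (t - A) with h | h
    · refine (hΦ.normHL2Sq_le hψ ht (by positivity) h
        fun r hr => (hclose r hr.1).le).trans ?_
      refine ENNReal.ofReal_le_of_le_toReal ?_
      rw [ENNReal.coe_toReal]
      linarith [hF t A hA htA]
    · rw [Icc_eq_empty (not_le.2 h)]
      simp [EquivariantWaveMap.normHL2Sq]
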